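/- For positive integers $m,n$ let $G^+_{m,n}$ be the monoid with generators $s,t_1,\dots,t_m,u_1,\dots,u_n$ and defining relations $[s,t_1,\dots,t_m]$, $[s,u_1,\dots,u_n]$ and $[t_i,u_j]$ ($1\le i\le m$, $1\le j\le n$), where $[x_1,\dots,x_k]$ stands for the cyclic relations $x_1x_2\cdots x_k=x_2\cdots x_kx_1=\cdots=x_kx_1\cdots x_{k-1}$. In a monoid, $a$ divides $b$ from the left (right) if $b=ac$ ($b=ca$) for some $c$. A right (left) common multiple of $a,b$ is an element that both divide from the left (right); it is a right (left) least common multiple if it divides every right (left) common multiple from the left (right). Let $\mathrm{mcm}_r(\{a,b\})$ be the set of right common multiples of $a,b$ that are not divisible from the left by any other right common multiple of $a,b$. Put $\Delta_1=s\,t_1\cdots t_m$, and let $F^+_{2,\mathrm{rm}}$ be the set of words $w(\underline u)$ in the free monoid on $u_1,\dots,u_n$ that are not divisible from the right by $u_1\cdots u_n$. **Proposition 5.3.** Let $m\ge 2$ and $n\ge 1$. Then, in $G^+_{m,n}$, $$\mathrm{mcm}_r(\{t_1,t_2\})=\{\,w(\underline u)\cdot\Delta_1 \mid w(\underline u)\in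 F^+_{2,\mathrm{rm}}\,\}.$$ If moreover $n\ge 2$, then this set is infinite, and $t_1,t_2$ have no right least common multiple. In that case $G^+_{m,n}$ does not always admit least common multiples: there is a pair of elements without a right least common multiple, and a pair of elements without a left least common multiple. Consequently, $G^+_{m,n}$ is neither a Garside monoid nor an Artin monoid. Here a Garside monoid is a finitely generated cancellative monoid $M$ with the following properties: there is $\nu:M\to\mathbb Z_{\ge0}$ with $\nu(a)=0\iff a=1$ and $\nu(ab)\ge\nu(a)+\nu(b)$; any two elements have a left and a right least common multiple; and there is an element whose sets of left and right divisors coincide, are finite and generate $M$. An Artin monoid is a monoid isomorphic to the one presented by the braid relations of some Coxeter matrix (of finite type or not). -/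

import Mathlib

namespace ArrMonoid

section Divisibility

variable {M : Type*} [Monoid M]

/-! Divisibility from the left, `b = a * c` for some `c`, is Mathlib's `a ∣ b`; divisibility from the
right, `b = c * a` for some `c`, is Mathlib's `a ∣ᵣ b`. -/

/-- The set of common right multiples of the elements of `J`. -/
def cmRight (J : Set M) : Set M := {x | ∀ j ∈ J, j ∣ x}

/-- The elements of `J` that are minimal for left divisibility. -/
def minRight (J : Set M) : Set M := {x | x ∈ J ∧ ∀ v ∈ J, v ∣ x → v = x}

/-- The set of minimal common right multiples of the elements of `J`. -/
def mcmRight (J : Set M) : Set M := minRight (cmRight J)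

/-- `c` is a right least common multiple of `a` and `b`: a common right multiple that divides
every common right multiple from the left. -/
def IsRightLCM (a b c : M) : Prop :=
  a ∣ c ∧ b ∣ c ∧ ∀ d, a ∣ d → b ∣ d → c ∣ d

/-- `c` is a left least common multiple of `a` and `b`: a common left multiple that divides
every common left multiple from the right. -/
def IsLeftLCM (a b c : M) : Prop :=
  a ∣ᵣ c ∧ b ∣ᵣ c ∧ ∀ d, a ∣ᵣ d → b ∣ᵣ d → c ∣ᵣ d

variable (M)

/-- Any two elements have a right least common multiple. -/
def HasRightLCMs : Prop := ∀ a b : M, ∃ c, IsRightLCM a b c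

/-- Any two elements have a left least common multiple. -/
def HasLeftLCMs : Prop := ∀ a b : M, ∃ c, IsLeftLCM a b c

/-- `M` is atomic: there is a superadditive `ν : M → ℕ` that vanishes exactly at `1`. -/
def IsAtomicMonoid : Prop :=
  ∃ ν : M → ℕ, (∀ a, ν a = 0 ↔ a = 1) ∧ ∀ a b, ν a + ν b ≤ ν (a * b)

variable {M}

/-- A Garside element: its left and right divisors coincide, are finite in number, and
generate the monoid. -/
def IsGarsideElement (d : M) : Prop :=
  {x : M | x ∣ d} = {x : M | x ∣ᵣ d} ∧
  Submonoid.closure {x : M | x ∣ d} = ⊤ ∧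
  {x : M | x ∣ d}.Finite

variable (M)

/-- A Garside monoid: finitely generated, cancellative, atomic, with left and right least common
multiples, and with a Garside element. -/
structure IsGarsideMonoid : Prop where
  fg : Monoid.FG M
  cancel : IsCancelMul M
  atomic : IsAtomicMonoid M
  rightLCM : HasRightLCMs M
  leftLCM : HasLeftLCMs M
  garside : ∃ d : M, IsGarsideElement d

end Divisibility

section Artin

/-- The braid relations of a Coxeter matrix `C`: for `i ≠ i'` with `C i i'` finite (Mathlib writes
the value `∞` as `0`), the two alternating words of length `C i i'` in `i` and `i'` are equal. -/
def BraidRel {B : Type*} (C : CoxeterMatrix B) (a b : FreeMonoid B) : Prop :=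
  ∃ i i' : B, i ≠ i' ∧ C i i' ≠ 0 ∧
    a = FreeMonoid.ofList (CoxeterSystem.alternatingWord i i' (C i i')) ∧
    b = FreeMonoid.ofList (CoxeterSystem.alternatingWord i' i (C i i'))

/-- The Artin monoid of a Coxeter matrix. -/
abbrev ArtinMonoid {B : Type*} (C : CoxeterMatrix B) : Type _ := PresentedMonoid (BraidRel C)

/-- `M` is isomorphic to the Artin monoid of some Coxeter matrix, of finite type or not. -/
def IsArtinMonoid.{u} (M : Type u) [Monoid M] : Prop :=
  ∃ (B : Type u) (C : CoxeterMatrix B), Nonempty (M ≃* ArtinMonoid C)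

end Artin

/-- The generators `s`, `t₁, …, tₘ`, `u₁, …, uₙ` (with indices shifted to start at `0`). -/
inductive Gen (m n : ℕ) : Type
  | s : Gen m n
  | t : Fin m → Gen m n
  | u : Fin n → Gen m n

/-- The cyclic relations `[x₁, …, xₖ]`: the word `x₁ ⋯ xₖ` equals each of its cyclic rotations. -/
def CyclicRel {α : Type*} (l : List α) (a b : FreeMonoid α) : Prop :=
  ∃ k, a = FreeMonoid.ofList l ∧ b = FreeMonoid.ofList (l.rotate k)

/-- The defining relations `[s, t₁, …, tₘ]`, `[s, u₁, …, uₙ]` and `[tᵢ, uⱼ]` for all `i`, `j`. -/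
def Rel (m n : ℕ) (a b : FreeMonoid (Gen m n)) : Prop :=
  CyclicRel (Gen.s :: (List.finRange m).map Gen.t) a b ∨
  CyclicRel (Gen.s :: (List.finRange n).map Gen.u) a b ∨
  ∃ i j, CyclicRel [Gen.t i, Gen.u j] a b

/-- The monoid `G⁺_{m,n}`. -/
abbrev GPlus (m n : ℕ) : Type := PresentedMonoid (Rel m n)

/-- The generator `s` in `G⁺_{m,n}`. -/
def gs (m n : ℕ) : GPlus m n := PresentedMonoid.of (Rel m n) Gen.s

/-- The generators `tᵢ` in `G⁺_{m,n}`. -/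
def gt (m n : ℕ) (i : Fin m) : GPlus m n := PresentedMonoid.of (Rel m n) (Gen.t i)

/-- The generators `uⱼ` in `G⁺_{m,n}`. -/
def gu (m n : ℕ) (j : Fin n) : GPlus m n := PresentedMonoid.of (Rel m n) (Gen.u j)

/-- `Δ₁ = s t₁ ⋯ tₘ`. -/
def Delta₁ (m n : ℕ) : GPlus m n := gs m n * ((List.finRange m).map (gt m n)).prod

/-- The words in `u₁, …, uₙ` that are not divisible from the right by `u₁ ⋯ uₙ`. -/
def F₂rm (n : ℕ) : Set (FreeMonoid (Fin n)) :=
  {w | ¬ (FreeMonoid.ofList (List.finRange n) ∣ᵣ w)}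

/-- The element of `G⁺_{m,n}` represented by a word in `u₁, …, uₙ`. -/
def uWord (m n : ℕ) : FreeMonoid (Fin n) →* GPlus m n := FreeMonoid.lift (gu m n)

end ArrMonoid

/-! The elements w(u)Δ₁c form a two-sided ideal, because s·wΔ₁ = Δ₁·ws (`DeltaMultiple.mul_left`).
Once the uⱼ are erased, only [s,t₁,…,tₘ] can change a word, and its sides lie in this ideal; outside
the ideal the erased word is therefore an invariant. A common right multiple of two distinct tᵢ has
two different erased words, so it lies in the ideal (`deltaMultiple_of_gt_dvd`). As u₁⋯uₙ commutes
with Δ₁, suffixes u₁⋯uₙ of w can be moved into c.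

For minimality the tᵢ are erased instead. If w has no suffix u₁⋯uₙ, then ws contains no rotation of
s u₁⋯uₙ, so it is the only erased word of wΔ₁, and vΔ₁ ∣ wΔ₁ forces v = w
(`eq_of_uWord_mul_Delta₁_dvd`). For n ≥ 2 the powers of one uⱼ give infinitely many minimal
multiples, whereas a least one would be the only one. An anti-automorphism carries the failure to
left multiples.

An isomorphism to an Artin monoid would send generators to generators. There a word with distinct
letters and no adjacent commuting ones is alone in its class, yet s t₁⋯tₘ = t₁⋯tₘ s. -/

namespace ArrMonoid

/-! ### Invariants modulo an ideal; homogeneous presentations -/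

section Presented

variable {α : Type*} {rel : FreeMonoid α → FreeMonoid α → Prop}

/-- If the two sides of every defining relation have the same image under `f`, or images in the
two-sided ideal `I`, then so do any two words representing the same element. -/
theorem eq_or_mem_ideal_of_mk_eq {N : Type*} [Monoid N] (f : FreeMonoid α →* N)
    (I : N → Prop) (hl : ∀ a b, I b → I (a * b)) (hr : ∀ a b, I a → I (a * b))
    (h : ∀ a b, rel a b → f a = f b ∨ (I (f a) ∧ I (f b))) {a b : FreeMonoid α}
    (hab : PresentedMonoid.mk rel a = PresentedMonoid.mk rel b) :
    f a = f b ∨ (I (f a) ∧ I (f b)) := by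
  have H : ConGen.Rel rel a b := PresentedMonoid.mk_eq_mk_iff.1 hab
  clear hab
  induction H with
  | of x y hxy => exact h x y hxy
  | refl x => exact Or.inl rfl
  | symm _ ih => exact ih.imp Eq.symm And.symm
  | trans _ _ ih₁ ih₂ => grind
  | mul _ _ ih₁ ih₂ =>
    rw [map_mul, map_mul]
    rcases ih₁ with h₁ | h₁
    · rcases ih₂ with h₂ | h₂
      · exact Or.inl (by rw [h₁, h₂])
      · exact Or.inr ⟨hl _ _ h₂.1, hl _ _ h₂.2⟩
    · exact Or.inr ⟨hr _ _ h₁.1, hr _ _ h₁.2⟩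

theorem lift_const_ofAdd (w : FreeMonoid α) :
    FreeMonoid.lift (fun _ : α => Multiplicative.ofAdd 1) w = Multiplicative.ofAdd w.length := by
  induction w using FreeMonoid.inductionOn' with
  | one => rfl
  | of_mul a w ih =>
    rw [map_mul, ih, FreeMonoid.lift_eval_of, FreeMonoid.length_mul, FreeMonoid.length_of, ofAdd_add]

/-- The length homomorphism of a homogeneous presentation. -/
def lengthHom (h : ∀ a b, rel a b → a.length = b.length) :
    PresentedMonoid rel →* Multiplicative ℕ :=
  PresentedMonoid.lift (fun _ => Multiplicative.ofAdd 1)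
    fun a b hab => by rw [lift_const_ofAdd, lift_const_ofAdd, h a b hab]

theorem lengthHom_mk (h : ∀ a b, rel a b → a.length = b.length) (w : FreeMonoid α) :
    lengthHom h (PresentedMonoid.mk rel w) = Multiplicative.ofAdd w.length :=
  lift_const_ofAdd w

theorem eq_one_of_lengthHom_eq_one (h : ∀ a b, rel a b → a.length = b.length)
    {x : PresentedMonoid rel} (hx : lengthHom h x = 1) : x = 1 := by
  induction x with
  | _ w =>
    rw [lengthHom_mk] at hx
    rw [FreeMonoid.length_eq_zero.1 (Multiplicative.ofAdd.injective hx), map_one]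

theorem mul_eq_one_of_homogeneous (h : ∀ a b, rel a b → a.length = b.length)
    {x y : PresentedMonoid rel} (hxy : x * y = 1) : x = 1 ∧ y = 1 := by
  have H := congrArg (lengthHom h) hxy
  rw [map_mul, map_one] at H
  have H' : (lengthHom h x).toAdd + (lengthHom h y).toAdd = 0 := congrArg Multiplicative.toAdd H
  exact ⟨eq_one_of_lengthHom_eq_one h (Multiplicative.toAdd.injective (by rw [toAdd_one]; omega)),
    eq_one_of_lengthHom_eq_one h (Multiplicative.toAdd.injective (by rw [toAdd_one]; omega))⟩

/-- Lengths add, so the cancellation takes place in ℕ and none is needed in the monoid. -/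
theorem eq_one_of_self_mul_eq (h : ∀ a b, rel a b → a.length = b.length)
    {x y : PresentedMonoid rel} (hxy : x * y = x) : y = 1 := by
  have H := congrArg (lengthHom h) hxy
  rw [map_mul, mul_eq_left] at H
  exact eq_one_of_lengthHom_eq_one h H

theorem dvd_antisymm_of_homogeneous (h : ∀ a b, rel a b → a.length = b.length)
    {x y : PresentedMonoid rel} (hxy : x ∣ y) (hyx : y ∣ x) : x = y := by
  obtain ⟨c, rfl⟩ := hxy
  obtain ⟨d, hd⟩ := hyx
  rw [mul_assoc] at hd
  rw [(mul_eq_one_of_homogeneous h (eq_one_of_self_mul_eq h hd.symm)).1, mul_one]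

theorem of_ne_one (h : ∀ a b, rel a b → a.length = b.length) (i : α) :
    PresentedMonoid.of rel i ≠ 1 := by
  intro hi
  have H := congrArg (lengthHom h) hi
  rw [PresentedMonoid.of, lengthHom_mk, map_one] at H
  exact one_ne_zero (Multiplicative.ofAdd.injective H : (1 : ℕ) = 0)

/-- The generators of a homogeneous presentation are indecomposable. -/
theorem of_eq_mul (h : ∀ a b, rel a b → a.length = b.length) (i : α)
    {x y : PresentedMonoid rel} (hxy : PresentedMonoid.of rel i = x * y) : x = 1 ∨ y = 1 := by
  have H := congrArg (lengthHom h) hxy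
  rw [PresentedMonoid.of, lengthHom_mk, map_mul] at H
  have H' : 1 = (lengthHom h x).toAdd + (lengthHom h y).toAdd := congrArg Multiplicative.toAdd H
  rcases Nat.eq_zero_or_pos (lengthHom h x).toAdd with h0 | h0
  · exact Or.inl (eq_one_of_lengthHom_eq_one h (Multiplicative.toAdd.injective (by rw [toAdd_one]; omega)))
  · exact Or.inr (eq_one_of_lengthHom_eq_one h (Multiplicative.toAdd.injective (by rw [toAdd_one]; omega)))

/-- The indecomposable elements of a homogeneous presentation are generators. -/
theorem exists_eq_of_of_indecomposable (h : ∀ a b, rel a b → a.length = b.length)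
    {z : PresentedMonoid rel} (hz : z ≠ 1) (hz' : ∀ x y, z = x * y → x = 1 ∨ y = 1) :
    ∃ i, z = PresentedMonoid.of rel i := by
  induction z with
  | _ w =>
    induction w using FreeMonoid.casesOn with
    | one => exact absurd (map_one _) hz
    | of_mul i w =>
      refine ⟨i, ?_⟩
      rw [map_mul] at hz' ⊢
      rcases hz' _ _ rfl with h1 | h1
      · exact absurd h1 (of_ne_one h i)
      · rw [h1, mul_one, PresentedMonoid.of]

end Presented

/-! ### Consequences of cyclic relations -/

section Cyclic

variable {N : Type*} [Monoid N] {l : List N}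

/-- For l = a x b, both bax and xba equal the product, and x(bax) = (xba)x. -/
theorem commute_prod_of_rotate (hl : ∀ k, (l.rotate k).prod = l.prod) {x : N} (hx : x ∈ l) :
    Commute x l.prod := by
  obtain ⟨a, b, rfl⟩ := List.append_of_mem hx
  have h₁ := hl a.length
  have h₂ := hl (a ++ [x]).length
  rw [List.rotate_append_length_eq] at h₁
  rw [List.append_cons, List.rotate_append_length_eq, ← List.append_cons] at h₂
  calc x * (a ++ x :: b).prod = x * (b ++ (a ++ [x])).prod := by rw [h₂]
    _ = (x :: b ++ a).prod * x := by simp [mul_assoc]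
    _ = (a ++ x :: b).prod * x := by rw [h₁]

theorem dvd_prod_of_rotate (hl : ∀ k, (l.rotate k).prod = l.prod) {x : N} (hx : x ∈ l) :
    x ∣ l.prod := by
  obtain ⟨a, b, rfl⟩ := List.append_of_mem hx
  have h₁ := hl a.length
  rw [List.rotate_append_length_eq, List.cons_append, List.prod_cons] at h₁
  exact ⟨_, h₁.symm⟩

theorem commute_head_of_rotate {x : N} {l : List N}
    (hl : ∀ k, ((x :: l).rotate k).prod = (x :: l).prod) : Commute l.prod x := by
  have := hl 1
  rw [List.rotate_cons_succ, List.rotate_zero] at this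
  simpa [Commute, SemiconjBy] using this

theorem CyclicRel.lift_eq {α : Type*} {l : List α} {a b : FreeMonoid α} (h : CyclicRel l a b)
    (f : α → N) (hl : ∀ k, ((l.map f).rotate k).prod = (l.map f).prod) :
    FreeMonoid.lift f a = FreeMonoid.lift f b := by
  obtain ⟨k, ha, hb⟩ := h
  rw [ha, hb, FreeMonoid.lift_ofList, FreeMonoid.lift_ofList, List.map_rotate, hl]

theorem CyclicRel.length_eq {α : Type*} {l : List α} {a b : FreeMonoid α} (h : CyclicRel l a b) :
    a.length = b.length := by
  obtain ⟨k, ha, hb⟩ := h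
  rw [ha, hb]
  exact (List.length_rotate l k).symm

theorem rotate_pair {α : Type*} (a b : α) (k : ℕ) :
    [a, b].rotate k = [a, b] ∨ [a, b].rotate k = [b, a] := by
  rw [← List.rotate_mod]
  have : k % [a, b].length < 2 := Nat.mod_lt _ (by simp)
  interval_cases k % [a, b].length <;> simp

end Cyclic

/-! ### The ideal of multiples of w(u)Δ₁ -/

section Relations

variable {m n : ℕ}

theorem Rel.length_eq (a b : FreeMonoid (Gen m n)) (h : Rel m n a b) : a.length = b.length := by
  rcases h with h | h | ⟨i, j, h⟩
  exacts [h.length_eq, h.length_eq, h.length_eq]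

variable (m n)

/-- The product `t₁ ⋯ tₘ`. -/
def tProd : GPlus m n := ((List.finRange m).map (gt m n)).prod

/-- The product `u₁ ⋯ uₙ`. -/
def uProd : GPlus m n := ((List.finRange n).map (gu m n)).prod

theorem Delta₁_eq : Delta₁ m n = gs m n * tProd m n := rfl

theorem mk_ofList (l : List (Gen m n)) :
    PresentedMonoid.mk (Rel m n) (FreeMonoid.ofList l) =
      (l.map (PresentedMonoid.of (Rel m n))).prod := by
  induction l with
  | nil => rfl
  | cons a l ih => rw [FreeMonoid.ofList_cons, map_mul, ih, List.map_cons, List.prod_cons]; rfl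

variable {m n} in
theorem CyclicRel.rotate_prod {l : List (Gen m n)}
    (h : ∀ a b, CyclicRel l a b → Rel m n a b) (k : ℕ) :
    ((l.map (PresentedMonoid.of (Rel m n))).rotate k).prod =
      (l.map (PresentedMonoid.of (Rel m n))).prod := by
  have := PresentedMonoid.mk_eq_mk_of_rel (h _ _ ⟨k, rfl, rfl⟩)
  rw [mk_ofList, mk_ofList] at this
  rw [← List.map_rotate, this]

theorem prod_rotate_t (k : ℕ) :
    ((gs m n :: (List.finRange m).map (gt m n)).rotate k).prod =
      (gs m n :: (List.finRange m).map (gt m n)).prod := by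
  have := CyclicRel.rotate_prod (fun a b h => (Or.inl h : Rel m n a b)) k
  simp only [List.map_cons, List.map_map] at this
  exact this

theorem prod_rotate_u (k : ℕ) :
    ((gs m n :: (List.finRange n).map (gu m n)).rotate k).prod =
      (gs m n :: (List.finRange n).map (gu m n)).prod := by
  have := CyclicRel.rotate_prod (fun a b h => (Or.inr (Or.inl h) : Rel m n a b)) k
  simp only [List.map_cons, List.map_map] at this
  exact this

theorem commute_gt_gu (i : Fin m) (j : Fin n) : Commute (gt m n i) (gu m n j) := by
  have := CyclicRel.rotate_prod (fun a b h => (Or.inr (Or.inr ⟨i, j, h⟩) : Rel m n a b)) 1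
  simp only [List.map_cons, List.map_nil, List.rotate_cons_succ, List.rotate_zero,
    List.nil_append, List.prod_cons, List.cons_append, List.prod_nil, mul_one] at this
  exact this.symm

theorem commute_gt_Delta₁ (i : Fin m) : Commute (gt m n i) (Delta₁ m n) :=
  commute_prod_of_rotate (prod_rotate_t m n)
    (List.mem_cons_of_mem _ (List.mem_map_of_mem (List.mem_finRange i)))

theorem gt_dvd_Delta₁ (i : Fin m) : gt m n i ∣ Delta₁ m n :=
  dvd_prod_of_rotate (prod_rotate_t m n)
    (List.mem_cons_of_mem _ (List.mem_map_of_mem (List.mem_finRange i)))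

theorem commute_tProd_gs : Commute (tProd m n) (gs m n) :=
  commute_head_of_rotate (prod_rotate_t m n)

theorem commute_uProd_gs : Commute (uProd m n) (gs m n) :=
  commute_head_of_rotate (prod_rotate_u m n)

variable {m n}

theorem commute_uWord {x : GPlus m n} (h : ∀ j, Commute x (gu m n j)) (w : FreeMonoid (Fin n)) :
    Commute x (uWord m n w) := by
  induction w using FreeMonoid.inductionOn' with
  | one => rw [map_one]; exact Commute.one_right x
  | of_mul a w ih => rw [map_mul]; exact (h a).mul_right ih

theorem commute_tProd_gu (j : Fin n) : Commute (tProd m n) (gu m n j) := by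
  refine Commute.list_prod_left _ _ fun x hx => ?_
  obtain ⟨i, -, rfl⟩ := List.mem_map.1 hx
  exact commute_gt_gu m n i j

theorem commute_gt_uWord (i : Fin m) (w : FreeMonoid (Fin n)) :
    Commute (gt m n i) (uWord m n w) := commute_uWord (commute_gt_gu m n i) w

theorem commute_tProd_uWord (w : FreeMonoid (Fin n)) :
    Commute (tProd m n) (uWord m n w) := commute_uWord commute_tProd_gu w

theorem uWord_finRange : uWord m n (FreeMonoid.ofList (List.finRange n)) = uProd m n :=
  FreeMonoid.lift_ofList _ _

/-- The product t₁⋯tₘ commutes with s and with every uⱼ, so it moves left past ws. The factor `1`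
stands for the empty word in u. -/
theorem gs_mul_uWord_mul_Delta₁ (w : FreeMonoid (Fin n)) :
    gs m n * (uWord m n w * Delta₁ m n) = 1 * Delta₁ m n * (uWord m n w * gs m n) := by
  have h : Commute (tProd m n) (uWord m n w * gs m n) :=
    (commute_tProd_uWord w).mul_right (commute_tProd_gs m n)
  rw [Delta₁_eq, ← mul_assoc (uWord m n w), ← h.eq, one_mul, mul_assoc]

theorem uProd_mul_Delta₁ : uProd m n * Delta₁ m n = Delta₁ m n * uProd m n := by
  have h : Commute (uProd m n) (tProd m n) := by
    rw [← uWord_finRange]; exact (commute_tProd_uWord _).symm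
  exact ((commute_uProd_gs m n).mul_right h).eq

/-- The elements divisible from the left by some `w(u) Δ₁`. -/
def DeltaMultiple (x : GPlus m n) : Prop := ∃ w c, x = uWord m n w * Delta₁ m n * c

theorem DeltaMultiple.mul_right {x : GPlus m n} (h : DeltaMultiple x) (y : GPlus m n) :
    DeltaMultiple (x * y) := by
  obtain ⟨w, c, rfl⟩ := h
  exact ⟨w, c * y, mul_assoc _ _ _⟩

/-- A letter tᵢ commutes with wΔ₁ and a letter uⱼ lengthens w; a letter s forms a new Δ₁ in front
and pushes w into the cofactor. -/
theorem DeltaMultiple.mul_left {x : GPlus m n} (h : DeltaMultiple x) (y : GPlus m n) :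
    DeltaMultiple (y * x) := by
  obtain ⟨y, rfl⟩ := PresentedMonoid.surjective_mk y
  induction y using FreeMonoid.inductionOn' with
  | one => rwa [map_one, one_mul]
  | of_mul a y ih =>
    rw [map_mul, mul_assoc]
    obtain ⟨w, c, hc⟩ := ih
    rw [hc]
    cases a with
    | s =>
      refine ⟨1, uWord m n w * gs m n * c, ?_⟩
      rw [map_one, ← mul_assoc (1 * Delta₁ m n), ← gs_mul_uWord_mul_Delta₁, mul_assoc (gs m n)]
      rfl
    | t i =>
      refine ⟨w, gt m n i * c, ?_⟩
      have h := ((commute_gt_uWord i w).mul_right (commute_gt_Delta₁ m n i)).eq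
      rw [← mul_assoc (uWord m n w * Delta₁ m n), ← h, mul_assoc (gt m n i)]
      rfl
    | u j =>
      refine ⟨FreeMonoid.of j * w, c, ?_⟩
      rw [map_mul, mul_assoc (uWord m n (FreeMonoid.of j)), mul_assoc (uWord m n (FreeMonoid.of j))]
      rfl

theorem DeltaMultiple.exists_F₂rm (hn : 1 ≤ n) {x : GPlus m n} (h : DeltaMultiple x) :
    ∃ w ∈ F₂rm n, uWord m n w * Delta₁ m n ∣ x := by
  obtain ⟨w, c, hx⟩ := h
  induction hk : w.length using Nat.strong_induction_on generalizing w c with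
  | _ k ih =>
    by_cases hw : w ∈ F₂rm n
    · exact ⟨w, hw, c, hx⟩
    · obtain ⟨v, rfl⟩ := not_not.1 hw
      -- The suffix u₁⋯uₙ passes through Δ₁ into the cofactor; it is nonempty, so w gets shorter.
      refine ih v.length ?_ v (uProd m n * c) ?_ rfl
      · rw [← hk, FreeMonoid.length_mul]
        have : (FreeMonoid.ofList (List.finRange n)).length = n := List.length_finRange
        omega
      · rw [hx, map_mul, uWord_finRange, mul_assoc (uWord m n v), uProd_mul_Delta₁]
        simp only [mul_assoc]

end Relations

/-! ### Erasing the uⱼ or the tᵢ; minimal common multiples -/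

section TProjection

variable (m n : ℕ)

/-- Erases the generators `uⱼ` from a word. -/
def tProj : FreeMonoid (Gen m n) →* FreeMonoid (Option (Fin m)) :=
  FreeMonoid.lift fun
    | .s => FreeMonoid.of none
    | .t i => FreeMonoid.of (some i)
    | .u _ => 1

/-- Erases the generators `tᵢ` from a word. -/
def uProj : FreeMonoid (Gen m n) →* FreeMonoid (Option (Fin n)) :=
  FreeMonoid.lift fun
    | .s => FreeMonoid.of none
    | .t _ => 1
    | .u j => FreeMonoid.of (some j)

variable {m n}

theorem tProj_eq_or_deltaMultiple {a b : FreeMonoid (Gen m n)}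
    (hab : PresentedMonoid.mk (Rel m n) a = PresentedMonoid.mk (Rel m n) b) :
    tProj m n a = tProj m n b ∨ DeltaMultiple (PresentedMonoid.mk (Rel m n) a) := by
  -- Pairing with the quotient map makes the ideal, which lives in the monoid, visible in the
  -- target.
  have H := eq_or_mem_ideal_of_mk_eq ((tProj m n).prod (PresentedMonoid.mk (Rel m n)))
    (fun p => DeltaMultiple p.2) (fun a b h => h.mul_left a.2) (fun a b h => h.mul_right b.2) ?_ hab
  · exact H.imp (fun h => congrArg Prod.fst h) And.left
  · intro a b h
    have hab := PresentedMonoid.mk_eq_mk_of_rel h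
    rcases h with h | h | ⟨i, j, h⟩
    · have ha : PresentedMonoid.mk (Rel m n) a = Delta₁ m n := by
        obtain ⟨k, ha, -⟩ := h
        rw [ha, mk_ofList, List.map_cons, List.map_map]
        rfl
      have hD : DeltaMultiple (Delta₁ m n) := ⟨1, 1, by rw [map_one, one_mul, mul_one]⟩
      refine Or.inr ⟨?_, ?_⟩
      · change DeltaMultiple (PresentedMonoid.mk (Rel m n) a)
        rwa [ha]
      · change DeltaMultiple (PresentedMonoid.mk (Rel m n) b)
        rwa [← hab, ha]
    · refine Or.inl (Prod.ext (h.lift_eq _ fun k => ?_) hab)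
      rw [List.map_cons, List.map_map]
      -- All entries but s are erased to 1, so the entries commute and rotation keeps the product.
      refine ((List.rotate_perm _ _).symm.prod_eq' (List.pairwise_cons.2 ⟨?_, ?_⟩)).symm
      · intro x hx
        obtain ⟨j, -, rfl⟩ := List.mem_map.1 hx
        exact Commute.one_right _
      · exact List.pairwise_map.2 (List.pairwise_of_forall fun _ _ => Commute.one_left _)
    · refine Or.inl (Prod.ext (h.lift_eq _ fun k => ?_) hab)
      rcases rotate_pair (FreeMonoid.of (some i)) (1 : FreeMonoid (Option (Fin m))) k with hk | hk <;>
        simp [hk]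

theorem uProj_ofList_map_t (l : List (Fin m)) :
    uProj m n (FreeMonoid.ofList (l.map Gen.t)) = 1 := by
  induction l with
  | nil => rfl
  | cons a l ih => rw [List.map_cons, FreeMonoid.ofList_cons, map_mul, ih]; rfl

/-- The words that contain as a factor some cyclic rotation of `s u₁ ⋯ uₙ`. -/
def HasUCycle (x : FreeMonoid (Option (Fin n))) : Prop :=
  ∃ (p : FreeMonoid (Option (Fin n))) (y z : List (Fin n)) (q : FreeMonoid (Option (Fin n))),
    z ++ y = List.finRange n ∧
    x.toList = p.toList ++ y.map some ++ none :: z.map some ++ q.toList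

theorem hasUCycle_of_rotate (k : ℕ) : HasUCycle
    (uProj m n (FreeMonoid.ofList ((Gen.s :: (List.finRange n).map Gen.u).rotate k))) := by
  have key : ∀ l : List (Gen m n), uProj m n (FreeMonoid.ofList l) = FreeMonoid.ofList
      (l.flatMap fun | .s => [none] | .t _ => [] | .u j => [some j]) := by
    intro l
    induction l with
    | nil => rfl
    | cons a l ih =>
      rw [FreeMonoid.ofList_cons, map_mul, ih]
      cases a <;> rfl
  have hu : ∀ l : List (Fin n), (l.map (Gen.u : _ → Gen m n)).flatMap
      (fun | .s => [none] | .t _ => [] | .u j => [some j]) = l.map some := by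
    intro l
    induction l with
    | nil => rfl
    | cons a l ih => rw [List.map_cons, List.flatMap_cons, ih]; rfl
  rw [key, List.rotate_eq_drop_append_take_mod]
  generalize k % _ = k
  cases k with
  | zero => exact ⟨1, [], List.finRange n, 1, by simp, by simp [hu]⟩
  | succ k =>
    -- Rotating by k + 1 moves s and the first k letters uⱼ to the end.
    refine ⟨1, (List.finRange n).drop k, (List.finRange n).take k, 1,
      List.take_append_drop _ _, ?_⟩
    rw [List.drop_succ_cons, List.take_succ_cons, ← List.map_drop, ← List.map_take,
      List.flatMap_append, List.flatMap_cons, hu, hu]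
    simp

/-- Only [s,u₁,…,uₙ] survives the erasure, and all its sides are rotations of the forbidden factor.
-/
theorem uProj_eq_or_hasUCycle {a b : FreeMonoid (Gen m n)}
    (hab : PresentedMonoid.mk (Rel m n) a = PresentedMonoid.mk (Rel m n) b) :
    uProj m n a = uProj m n b ∨ (HasUCycle (uProj m n a) ∧ HasUCycle (uProj m n b)) := by
  refine eq_or_mem_ideal_of_mk_eq (uProj m n) HasUCycle ?_ ?_ ?_ hab
  · rintro a b ⟨p, y, z, q, h, hb⟩
    exact ⟨a * p, y, z, q, h, by rw [FreeMonoid.toList_mul, hb]; simp⟩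
  · rintro a b ⟨p, y, z, q, h, hb⟩
    exact ⟨p, y, z, q * b, h, by rw [FreeMonoid.toList_mul, hb]; simp⟩
  · rintro a b (h | h | ⟨i, j, h⟩)
    · refine Or.inl (h.lift_eq _ fun k => ?_)
      rw [List.map_cons, List.map_map]
      refine ((List.rotate_perm _ _).symm.prod_eq' (List.pairwise_cons.2 ⟨?_, ?_⟩)).symm
      · intro x hx
        obtain ⟨j, -, rfl⟩ := List.mem_map.1 hx
        exact Commute.one_right _
      · exact List.pairwise_map.2 (List.pairwise_of_forall fun _ _ => Commute.one_left _)
    · obtain ⟨k, ha, hb⟩ := h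
      refine Or.inr ⟨?_, hb ▸ hasUCycle_of_rotate k⟩
      have := hasUCycle_of_rotate (m := m) (n := n) 0
      rwa [List.rotate_zero, ← ha] at this
    · refine Or.inl (h.lift_eq _ fun k => ?_)
      rcases rotate_pair (1 : FreeMonoid (Option (Fin n))) (FreeMonoid.of (some j)) k with hk | hk <;>
        simp [hk]

/-- A word in the `uⱼ` as a word in all generators. -/
def uLift (m n : ℕ) : FreeMonoid (Fin n) →* FreeMonoid (Gen m n) := FreeMonoid.map Gen.u

theorem mk_uLift (w : FreeMonoid (Fin n)) :
    PresentedMonoid.mk (Rel m n) (uLift m n w) = uWord m n w := by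
  have : (PresentedMonoid.mk (Rel m n)).comp (uLift m n) = uWord m n :=
    FreeMonoid.hom_eq fun _ => rfl
  exact DFunLike.congr_fun this w

theorem uProj_uLift (w : FreeMonoid (Fin n)) :
    uProj m n (uLift m n w) = FreeMonoid.map some w := by
  have : (uProj m n).comp (uLift m n) = FreeMonoid.map some := FreeMonoid.hom_eq fun _ => rfl
  exact DFunLike.congr_fun this w

/-- The word `s t₁ ⋯ tₘ`. -/
def deltaWord (m n : ℕ) : FreeMonoid (Gen m n) :=
  FreeMonoid.ofList (Gen.s :: (List.finRange m).map Gen.t)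

theorem mk_deltaWord : PresentedMonoid.mk (Rel m n) (deltaWord m n) = Delta₁ m n := by
  rw [deltaWord, mk_ofList, List.map_cons, List.map_map]
  rfl

theorem uProj_deltaWord : uProj m n (deltaWord m n) = FreeMonoid.of none := by
  rw [deltaWord, FreeMonoid.ofList_cons, map_mul, uProj_ofList_map_t, mul_one]
  rfl

theorem append_cons_none_inj {α : Type*} {v w : List α} {c d : List (Option α)}
    (h : v.map some ++ none :: c = w.map some ++ none :: d) : v = w ∧ c = d := by
  induction v generalizing w with
  | nil => cases w <;> simp_all
  | cons a v ih =>
    cases w with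
    | nil => simp at h
    | cons b w =>
      simp only [List.map_cons, List.cons_append, List.cons.injEq, Option.some.injEq] at h
      obtain ⟨h₁, h₂⟩ := ih h.2
      exact ⟨by rw [h.1, h₁], h₂⟩

/-- The only `none` is the last letter, so a cyclic factor would have to be u₁⋯uₙ s, which makes
u₁⋯uₙ a suffix of w. -/
theorem not_hasUCycle {w : FreeMonoid (Fin n)} (hw : w ∈ F₂rm n) :
    ¬ HasUCycle (FreeMonoid.map some w * FreeMonoid.of none) := by
  rintro ⟨p, y, z, q, hzy, h⟩
  have hlast : none :: z.map some ++ q.toList = [none] := by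
    have hne : ∀ r : List (Option (Fin n)), none :: (z.map some ++ q.toList) = r ++ [none] →
        r = [] ∨ none ∈ r := by
      intro r hr
      cases r with
      | nil => exact Or.inl rfl
      | cons a r => exact Or.inr (by simp_all)
    have h' : w.toList.map some ++ [none] =
        (p.toList ++ y.map some) ++ none :: (z.map some ++ q.toList) := by
      simpa using h
    rcases List.append_eq_append_iff.1 h' with ⟨r, hr, hr'⟩ | ⟨r, hr, hr'⟩
    · cases r with
      | nil => exact hr'.symm
      | cons a r => simp at hr'
    · rcases hne r hr' with rfl | hmem
      · simpa using hr'
      · have : none ∈ w.toList.map some := by rw [hr]; simp [hmem]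
        simp at this
  simp only [List.cons_append, List.cons.injEq, List.append_eq_nil_iff, List.map_eq_nil_iff,
    true_and] at hlast
  obtain ⟨rfl, hq⟩ := hlast
  rw [List.nil_append] at hzy
  have h' : w.toList.map some = p.toList ++ (List.finRange n).map some := by
    have : w.toList.map some ++ [none] = p.toList ++ (List.finRange n).map some ++ [none] := by
      simpa [hq, hzy] using h
    exact List.append_cancel_right this
  obtain ⟨c, d, hcd, -, hd⟩ := List.map_eq_append_iff.1 h'
  have hd' : d = List.finRange n := List.map_injective_iff.2 (Option.some_injective _) hd
  exact hw ⟨FreeMonoid.ofList c, by rw [← hd']; exact hcd⟩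

theorem eq_of_uWord_mul_Delta₁_dvd {v w : FreeMonoid (Fin n)} (hw : w ∈ F₂rm n)
    (h : uWord m n v * Delta₁ m n ∣ uWord m n w * Delta₁ m n) : v = w := by
  obtain ⟨c, hc⟩ := h
  obtain ⟨c, rfl⟩ := PresentedMonoid.surjective_mk c
  rw [← mk_uLift, ← mk_uLift, ← mk_deltaWord, ← map_mul, ← map_mul, ← map_mul] at hc
  rcases uProj_eq_or_hasUCycle hc with h | ⟨h, -⟩
  · simp only [map_mul, uProj_uLift, uProj_deltaWord, mul_assoc] at h
    exact (append_cons_none_inj (c := []) (congrArg FreeMonoid.toList h)).1.symm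
  · rw [map_mul, uProj_uLift, uProj_deltaWord] at h
    exact absurd h (not_hasUCycle hw)

/-- Words of length at most m thus avoid the ideal, so `tProj` distinguishes the elements they
represent. -/
theorem DeltaMultiple.length_le {w : FreeMonoid (Gen m n)}
    (h : DeltaMultiple (PresentedMonoid.mk (Rel m n) w)) : m + 1 ≤ w.length := by
  obtain ⟨v, c, hc⟩ := h
  have hD : lengthHom Rel.length_eq (Delta₁ m n) = Multiplicative.ofAdd (m + 1) := by
    rw [← mk_deltaWord, lengthHom_mk]
    simp [deltaWord, FreeMonoid.length]
  have H := congrArg (fun x => (lengthHom Rel.length_eq x).toAdd) hc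
  simp only [map_mul, hD, lengthHom_mk, toAdd_mul, toAdd_ofAdd] at H
  omega

theorem deltaMultiple_of_gt_dvd {i j : Fin m} (hij : i ≠ j) {x : GPlus m n}
    (hi : gt m n i ∣ x) (hj : gt m n j ∣ x) : DeltaMultiple x := by
  obtain ⟨a, rfl⟩ := hi
  obtain ⟨b, hb⟩ := hj
  obtain ⟨a, rfl⟩ := PresentedMonoid.surjective_mk a
  obtain ⟨b, rfl⟩ := PresentedMonoid.surjective_mk b
  have hb' : PresentedMonoid.mk (Rel m n) (FreeMonoid.of (Gen.t i) * a) =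
      PresentedMonoid.mk (Rel m n) (FreeMonoid.of (Gen.t j) * b) := by
    rw [map_mul, map_mul]; exact hb
  rcases tProj_eq_or_deltaMultiple hb' with h | h
  · rw [map_mul, map_mul] at h
    have h' : some i :: (tProj m n a).toList = some j :: (tProj m n b).toList :=
      congrArg FreeMonoid.toList h
    simp [hij] at h'
  · rwa [map_mul] at h

theorem mcmRight_gt (hn : 1 ≤ n) {i j : Fin m} (hij : i ≠ j) :
    mcmRight ({gt m n i, gt m n j} : Set (GPlus m n)) =
      {x | ∃ w ∈ F₂rm n, x = uWord m n w * Delta₁ m n} := by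
  have hcm : ∀ (w : FreeMonoid (Fin n)) (k : Fin m), gt m n k ∣ uWord m n w * Delta₁ m n := by
    intro w k
    obtain ⟨c, hc⟩ := gt_dvd_Delta₁ m n k
    exact ⟨uWord m n w * c, by rw [hc, ← mul_assoc, ← mul_assoc, (commute_gt_uWord k w).eq]⟩
  have hcm' : ∀ w, uWord m n w * Delta₁ m n ∈ cmRight ({gt m n i, gt m n j} : Set (GPlus m n)) := by
    rintro w k (rfl | rfl) <;> exact hcm w _
  have hex : ∀ x ∈ cmRight ({gt m n i, gt m n j} : Set (GPlus m n)),
      ∃ w ∈ F₂rm n, uWord m n w * Delta₁ m n ∣ x := fun x hx =>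
    (deltaMultiple_of_gt_dvd hij (hx _ (Or.inl rfl)) (hx _ (Or.inr rfl))).exists_F₂rm hn
  ext x
  constructor
  · rintro ⟨hx, hmin⟩
    obtain ⟨w, hw, hwx⟩ := hex x hx
    exact ⟨w, hw, (hmin _ (hcm' w) hwx).symm⟩
  · rintro ⟨w, hw, rfl⟩
    refine ⟨hcm' w, fun v hv hvw => ?_⟩
    -- Some w'Δ₁ divides v and hence wΔ₁; then w' = w, and v and wΔ₁ divide each other.
    obtain ⟨w', hw', hv'⟩ := hex v hv
    have := eq_of_uWord_mul_Delta₁_dvd hw (hv'.trans hvw)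
    subst this
    exact dvd_antisymm_of_homogeneous Rel.length_eq hvw hv'

/-- The letter k occurs in u₁⋯uₙ but not in a power of j. -/
theorem of_pow_mem_F₂rm {j k : Fin n} (hjk : j ≠ k) (e : ℕ) : FreeMonoid.of j ^ e ∈ F₂rm n := by
  rintro ⟨c, hc⟩
  have hk : k ∈ FreeMonoid.of j ^ e := by
    rw [hc, FreeMonoid.mem_mul]
    exact Or.inr (List.mem_finRange k)
  clear hc
  induction e with
  | zero => exact FreeMonoid.notMem_one hk
  | succ e ih =>
    rw [pow_succ, FreeMonoid.mem_mul] at hk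
    exact hk.elim ih fun h => hjk (FreeMonoid.mem_of.1 h).symm

theorem infinite_mcmRight_gt {i j : Fin m} (hij : i ≠ j) (hn : 2 ≤ n) :
    (mcmRight ({gt m n i, gt m n j} : Set (GPlus m n))).Infinite := by
  rw [mcmRight_gt (by omega) hij]
  have h01 : (⟨0, by omega⟩ : Fin n) ≠ ⟨1, by omega⟩ := by simp
  generalize (⟨0, by omega⟩ : Fin n) = k, (⟨1, by omega⟩ : Fin n) = k' at h01
  refine Set.infinite_of_injective_forall_mem
    (f := fun e : ℕ => uWord m n (FreeMonoid.of k ^ e) * Delta₁ m n) (fun e e' h => ?_)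
    fun e => ⟨_, of_pow_mem_F₂rm h01 e, rfl⟩
  have := eq_of_uWord_mul_Delta₁_dvd (of_pow_mem_F₂rm h01 e') ⟨1, (h.symm.trans (mul_one _).symm)⟩
  have hlen : ∀ e : ℕ, (FreeMonoid.of k ^ e).length = e := by
    intro e
    induction e with
    | zero => rfl
    | succ e ih => rw [pow_succ, FreeMonoid.length_mul, ih, FreeMonoid.length_of]
  rw [← hlen e, this, hlen]

theorem not_exists_isRightLCM_gt {i j : Fin m} (hij : i ≠ j) (hn : 2 ≤ n) :
    ¬ ∃ c, IsRightLCM (gt m n i) (gt m n j) c := by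
  rintro ⟨c, hi, hj, hc⟩
  refine infinite_mcmRight_gt hij hn ((Set.finite_singleton c).subset fun x hx => ?_)
  refine (hx.2 c ?_ (hc x (hx.1 _ (Or.inl rfl)) (hx.1 _ (Or.inr rfl)))).symm
  rintro k (rfl | rfl)
  exacts [hi, hj]

end TProjection

/-! ### An anti-automorphism exchanging left and right multiples -/

section Reversal

variable (m n : ℕ)

/-- The anti-automorphism that fixes `s` and reverses the order of the `tᵢ` and of the `uⱼ`. -/
def reversal : GPlus m n →* (GPlus m n)ᵐᵒᵖ :=
  PresentedMonoid.lift (fun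
    | .s => MulOpposite.op (gs m n)
    | .t i => MulOpposite.op (gt m n i.rev)
    | .u j => MulOpposite.op (gu m n j.rev)) <| by
  have key : ∀ {k : ℕ} (f : Fin k → GPlus m n) (e : ℕ),
      (∀ e, ((gs m n :: (List.finRange k).map f).rotate e).prod =
        (gs m n :: (List.finRange k).map f).prod) →
      ((MulOpposite.op (gs m n) ::
        (List.finRange k).map (fun i => MulOpposite.op (f i.rev))).rotate e).prod =
      (MulOpposite.op (gs m n) :: (List.finRange k).map (fun i => MulOpposite.op (f i.rev))).prod := by
    intro k f e hf
    -- Reversing the list puts s last and restores the original index order: a rotation by one.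
    have hrev : (gs m n :: (List.finRange k).map (fun i => f i.rev)).reverse =
        (gs m n :: (List.finRange k).map f).rotate 1 := by
      rw [List.reverse_cons, ← List.map_reverse, List.finRange_reverse, List.map_map,
        List.rotate_cons_succ, List.rotate_zero]
      congr 2
      funext i
      simp
    have hop : MulOpposite.op (gs m n) :: (List.finRange k).map (fun i => MulOpposite.op (f i.rev)) =
        (gs m n :: (List.finRange k).map (fun i => f i.rev)).map MulOpposite.op := by
      simp [Function.comp_def]
    have hprod : ∀ l : List (GPlus m n), (l.map MulOpposite.op).prod =
        MulOpposite.op l.reverse.prod := fun l => by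
      rw [MulOpposite.op_list_prod, List.map_reverse, List.reverse_reverse]
    rw [hop, ← List.map_rotate, hprod, hprod, List.reverse_rotate, hrev, List.rotate_rotate, hf, hf]
  rintro a b (h | h | ⟨i, j, h⟩)
  · refine h.lift_eq _ fun e => ?_
    rw [List.map_cons, List.map_map]
    exact key (gt m n) e (prod_rotate_t m n)
  · refine h.lift_eq _ fun e => ?_
    rw [List.map_cons, List.map_map]
    exact key (gu m n) e (prod_rotate_u m n)
  · refine h.lift_eq _ fun e => ?_
    simp only [List.map_cons, List.map_nil]
    rcases rotate_pair (MulOpposite.op (gt m n i.rev)) (MulOpposite.op (gu m n j.rev)) e with he | he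
    · rw [he]
    · rw [he]
      simp only [List.prod_cons, List.prod_nil, mul_one, ← MulOpposite.op_mul,
        (commute_gt_gu m n i.rev j.rev).eq]

variable {m n}

theorem unop_reversal_mul (x y : GPlus m n) :
    (reversal m n (x * y)).unop = (reversal m n y).unop * (reversal m n x).unop := by
  rw [map_mul, MulOpposite.unop_mul]

theorem reversal_reversal (x : GPlus m n) :
    (reversal m n (reversal m n x).unop).unop = x := by
  obtain ⟨x, rfl⟩ := PresentedMonoid.surjective_mk x
  induction x using FreeMonoid.inductionOn' with
  | one => simp
  | of_mul a w ih =>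
    rw [map_mul, unop_reversal_mul, unop_reversal_mul, ih]
    congr 1
    cases a with
    | s => rfl
    | t i => exact congrArg (gt m n) (Fin.rev_rev i)
    | u j => exact congrArg (gu m n) (Fin.rev_rev j)

theorem dvd_unop_reversal {x y : GPlus m n} (h : x ∣ᵣ y) :
    (reversal m n x).unop ∣ (reversal m n y).unop := by
  obtain ⟨c, rfl⟩ := h
  exact ⟨_, unop_reversal_mul _ _⟩

theorem rightDvd_unop_reversal {x y : GPlus m n} (h : x ∣ y) :
    (reversal m n x).unop ∣ᵣ (reversal m n y).unop := by
  obtain ⟨c, rfl⟩ := h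
  exact ⟨_, unop_reversal_mul _ _⟩

theorem IsLeftLCM.unop_reversal {a b c : GPlus m n} (h : IsLeftLCM a b c) :
    IsRightLCM (reversal m n a).unop (reversal m n b).unop (reversal m n c).unop := by
  refine ⟨dvd_unop_reversal h.1, dvd_unop_reversal h.2.1, fun d had hbd => ?_⟩
  have had' := rightDvd_unop_reversal had
  have hbd' := rightDvd_unop_reversal hbd
  rw [reversal_reversal] at had' hbd'
  have := dvd_unop_reversal (h.2.2 _ had' hbd')
  rwa [reversal_reversal] at this

theorem HasLeftLCMs.hasRightLCMs (h : HasLeftLCMs (GPlus m n)) : HasRightLCMs (GPlus m n) := by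
  intro a b
  obtain ⟨c, hc⟩ := h (reversal m n a).unop (reversal m n b).unop
  have := hc.unop_reversal
  rw [reversal_reversal, reversal_reversal] at this
  exact ⟨_, this⟩

end Reversal

/-! ### Comparison with Artin monoids -/

section NotArtin

variable {B : Type*} {C : CoxeterMatrix B}

theorem BraidRel.length_eq (a b : FreeMonoid B) (h : BraidRel C a b) : a.length = b.length := by
  obtain ⟨i, j, -, -, rfl, rfl⟩ := h
  exact (CoxeterSystem.length_alternatingWord i j _).trans
    (CoxeterSystem.length_alternatingWord j i _).symm

/-- A word without repeated letters and without adjacent commuting letters is the only word that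
represents its element of the Artin monoid. -/
theorem eq_of_mk_eq_of_nodup {l l' : List B} (hl : l.Nodup)
    (hC : ∀ p q i j, l = p ++ i :: j :: q → C i j ≠ 2)
    (h : PresentedMonoid.mk (BraidRel C) (FreeMonoid.ofList l) =
      PresentedMonoid.mk (BraidRel C) (FreeMonoid.ofList l')) : l = l' := by
  -- Every side of a braid relation lies in this ideal: either it is a product of two commuting
  -- letters, or it has length at least 3 and repeats a letter.
  have H := eq_or_mem_ideal_of_mk_eq (MonoidHom.id (FreeMonoid B))
    (fun x => ¬ x.toList.Nodup ∨ ∃ p q i j, x.toList = p ++ i :: j :: q ∧ C i j = 2) ?_ ?_ ?_ h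
  · rcases H with H | ⟨H | ⟨p, q, i, j, H, hij⟩, -⟩
    · exact H
    · exact absurd hl H
    · exact absurd hij (hC p q i j H)
  · rintro a b (hb | ⟨p, q, i, j, hb, hij⟩)
    · exact Or.inl fun h => hb (List.nodup_append.1 h).2.1
    · exact Or.inr ⟨a.toList ++ p, q, i, j, by rw [FreeMonoid.toList_mul, hb]; simp, hij⟩
  · rintro a b (hb | ⟨p, q, i, j, hb, hij⟩)
    · exact Or.inl fun h => hb (List.nodup_append.1 h).1
    · exact Or.inr ⟨p, q ++ b.toList, i, j, by rw [FreeMonoid.toList_mul, hb]; simp, hij⟩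
  · have key : ∀ i j, i ≠ j → C i j ≠ 0 →
        ¬ (CoxeterSystem.alternatingWord i j (C i j)).Nodup ∨
        ∃ p q k l, CoxeterSystem.alternatingWord i j (C i j) = p ++ k :: l :: q ∧ C k l = 2 := by
      intro i j hij h0
      have h1 : C i j ≠ 1 := C.off_diagonal i j hij
      by_cases h2 : C i j = 2
      · exact Or.inr ⟨[], [], i, j, by rw [h2]; rfl, h2⟩
      · refine Or.inl fun hnd => ?_
        have hlen := CoxeterSystem.length_alternatingWord i j (C i j)
        -- Here C i j ≥ 3, and an alternating word has equal letters at positions 0 and 2.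
        have := (hnd.getElem_inj_iff (i := 0) (j := 2) (hi := by omega) (hj := by omega)).1 (by
          rw [CoxeterSystem.getElem_alternatingWord _ _ _ _ (by omega),
            CoxeterSystem.getElem_alternatingWord _ _ _ _ (by omega)]
          simp [Nat.even_add])
        omega
    rintro a b ⟨i, j, hij, h0, rfl, rfl⟩
    refine Or.inr ⟨key i j hij h0, ?_⟩
    rw [C.symmetric i j]
    exact key j i hij.symm (by rwa [C.symmetric j i])

theorem commute_of_of_eq_two {i j : B} (h : C i j = 2) :
    Commute (PresentedMonoid.of (BraidRel C) i) (PresentedMonoid.of (BraidRel C) j) := by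
  have hij : i ≠ j := by
    rintro rfl
    rw [C.diagonal] at h
    omega
  refine PresentedMonoid.mk_eq_mk_of_rel ⟨i, j, hij, by omega, ?_, ?_⟩ <;> rw [h] <;> rfl

theorem tProj_of_mem {m n : ℕ} {a : Gen m n} (ha : a ∈ Gen.s :: (List.finRange m).map Gen.t) :
    ∃ o, tProj m n (FreeMonoid.of a) = FreeMonoid.of o := by
  cases a with
  | s => exact ⟨none, rfl⟩
  | t i => exact ⟨some i, rfl⟩
  | u j => simp at ha

theorem tProj_of_injOn {m n : ℕ} {a b : Gen m n}
    (ha : a ∈ Gen.s :: (List.finRange m).map Gen.t) (hb : b ∈ Gen.s :: (List.finRange m).map Gen.t)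
    (h : tProj m n (FreeMonoid.of a) = tProj m n (FreeMonoid.of b)) : a = b := by
  cases a <;> cases b <;>
    simp_all [tProj, FreeMonoid.of_injective.eq_iff]

/-- Two distinct generators among `s, t₁, …, tₘ` do not commute. -/
theorem not_commute_of_t {m n : ℕ} (hm : 2 ≤ m) {a b : Gen m n}
    (ha : a ∈ Gen.s :: (List.finRange m).map Gen.t) (hb : b ∈ Gen.s :: (List.finRange m).map Gen.t)
    (hab : a ≠ b) :
    ¬ Commute (PresentedMonoid.of (Rel m n) a) (PresentedMonoid.of (Rel m n) b) := by
  intro h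
  have h' : PresentedMonoid.mk (Rel m n) (FreeMonoid.of a * FreeMonoid.of b) =
      PresentedMonoid.mk (Rel m n) (FreeMonoid.of b * FreeMonoid.of a) := by
    rw [map_mul, map_mul]; exact h
  rcases tProj_eq_or_deltaMultiple h' with h | h
  · obtain ⟨o, ho⟩ := tProj_of_mem ha
    obtain ⟨o', ho'⟩ := tProj_of_mem hb
    rw [map_mul, map_mul, ho, ho'] at h
    have := (List.cons.inj (congrArg FreeMonoid.toList h)).1
    exact hab (tProj_of_injOn ha hb (by rw [ho, ho', this]))
  · have := h.length_le
    rw [FreeMonoid.length_mul, FreeMonoid.length_of, FreeMonoid.length_of] at this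
    omega

theorem of_injective {m n : ℕ} (hm : 1 ≤ m) {a b : Gen m n}
    (ha : a ∈ Gen.s :: (List.finRange m).map Gen.t) (hb : b ∈ Gen.s :: (List.finRange m).map Gen.t)
    (hab : PresentedMonoid.of (Rel m n) a = PresentedMonoid.of (Rel m n) b) : a = b := by
  rcases tProj_eq_or_deltaMultiple hab with h | h
  · exact tProj_of_injOn ha hb h
  · have := h.length_le
    rw [FreeMonoid.length_of] at this
    omega

theorem not_isArtinMonoid {m n : ℕ} (hm : 2 ≤ m) : ¬ IsArtinMonoid (GPlus m n) := by
  rintro ⟨B, C, ⟨e⟩⟩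
  -- On both sides the generators are exactly the indecomposable elements.
  have hgen : ∀ a, ∃ i, e (PresentedMonoid.of (Rel m n) a) = PresentedMonoid.of (BraidRel C) i := by
    intro a
    refine exists_eq_of_of_indecomposable BraidRel.length_eq ?_ fun x y hxy => ?_
    · rw [Ne, EmbeddingLike.map_eq_one_iff]
      exact of_ne_one Rel.length_eq a
    · have := congrArg e.symm hxy
      rw [e.symm_apply_apply, map_mul] at this
      simpa using of_eq_mul Rel.length_eq a this
  choose β hβ using hgen
  have hmk : ∀ l : List (Gen m n), e (PresentedMonoid.mk (Rel m n) (FreeMonoid.ofList l)) =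
      PresentedMonoid.mk (BraidRel C) (FreeMonoid.ofList (l.map β)) := by
    intro l
    induction l with
    | nil => rw [FreeMonoid.ofList_nil, map_one, map_one]; rfl
    | cons a l ih =>
      rw [List.map_cons, FreeMonoid.ofList_cons, FreeMonoid.ofList_cons, map_mul, map_mul, map_mul, ih]
      exact congrArg (· * _) (hβ a)
  set L : List (Gen m n) := Gen.s :: (List.finRange m).map Gen.t with hL
  have hLnd : L.Nodup := by
    refine List.nodup_cons.2 ⟨by simp, (List.nodup_finRange m).map fun i j h => ?_⟩
    injection h
  have hinj : ∀ a ∈ L, ∀ b ∈ L, β a = β b → a = b := fun a ha b hb h =>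
    of_injective (by omega) ha hb (e.injective (by rw [hβ, hβ, h]))
  have hnd : (L.map β).Nodup := (List.nodup_map_iff_inj_on hLnd).2 hinj
  have hrot : PresentedMonoid.mk (Rel m n) (FreeMonoid.ofList L) =
      PresentedMonoid.mk (Rel m n) (FreeMonoid.ofList (L.rotate 1)) :=
    PresentedMonoid.mk_eq_mk_of_rel (Or.inl ⟨1, rfl, rfl⟩)
  have hrot' := congrArg e hrot
  rw [hmk, hmk] at hrot'
  have heq := eq_of_mk_eq_of_nodup hnd ?_ hrot'
  -- The first letters of s t₁⋯tₘ and of its rotation by one have equal images.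
  · have : β Gen.s = β (Gen.t ⟨0, by omega⟩) := by
      rw [hL] at heq
      obtain ⟨k, rfl⟩ : ∃ k, m = k + 1 := ⟨m - 1, by omega⟩
      rw [List.rotate_cons_succ, List.rotate_zero, List.finRange_succ] at heq
      exact (List.cons.inj heq).1
    have := hinj _ (by simp [hL]) _ (by simp [hL]) this
    cases this
  · intro p q i j hpq hij
    obtain ⟨p', r, hL', -, hr⟩ := List.map_eq_append_iff.1 hpq
    obtain ⟨a, r', rfl, rfl, hr'⟩ := List.map_eq_cons_iff.1 hr
    obtain ⟨b, q', rfl, rfl, -⟩ := List.map_eq_cons_iff.1 hr'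
    have hc := commute_of_of_eq_two hij
    rw [← hβ, ← hβ] at hc
    refine not_commute_of_t hm (n := n) (a := a) (b := b) ?_ ?_ ?_ ?_
    · rw [← hL, hL']; simp
    · rw [← hL, hL']; simp
    · rintro rfl
      rw [hL'] at hLnd
      simp [List.nodup_append] at hLnd
    · have := hc.map e.symm
      simpa using this

end NotArtin

end ArrMonoid

theorem proposition5p3 (m n : ℕ) (hm : 2 ≤ m) (hn : 1 ≤ n) :
    ArrMonoid.mcmRight
        ({ArrMonoid.gt m n ⟨0, by omega⟩, ArrMonoid.gt m n ⟨1, by omega⟩} :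
          Set (ArrMonoid.GPlus m n)) =
      {x | ∃ w ∈ ArrMonoid.F₂rm n, x = ArrMonoid.uWord m n w * ArrMonoid.Delta₁ m n} ∧
    (2 ≤ n →
      (ArrMonoid.mcmRight
        ({ArrMonoid.gt m n ⟨0, by omega⟩, ArrMonoid.gt m n ⟨1, by omega⟩} :
          Set (ArrMonoid.GPlus m n))).Infinite ∧
      (¬ ∃ c, ArrMonoid.IsRightLCM
        (ArrMonoid.gt m n ⟨0, by omega⟩) (ArrMonoid.gt m n ⟨1, by omega⟩) c) ∧
      ¬ ArrMonoid.HasRightLCMs (ArrMonoid.GPlus m n) ∧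
      ¬ ArrMonoid.HasLeftLCMs (ArrMonoid.GPlus m n) ∧
      ¬ ArrMonoid.IsGarsideMonoid (ArrMonoid.GPlus m n) ∧
      ¬ ArrMonoid.IsArtinMonoid (ArrMonoid.GPlus m n)) := by
  have h01 : (⟨0, by omega⟩ : Fin m) ≠ ⟨1, by omega⟩ := by simp
  refine ⟨ArrMonoid.mcmRight_gt hn h01, fun hn2 => ?_⟩
  have hlcm := ArrMonoid.not_exists_isRightLCM_gt (n := n) h01 hn2
  have hright : ¬ ArrMonoid.HasRightLCMs (ArrMonoid.GPlus m n) := fun h => hlcm (h _ _)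
  exact ⟨ArrMonoid.infinite_mcmRight_gt h01 hn2, hlcm, hright, fun h => hright h.hasRightLCMs,
    fun h => hright h.rightLCM, ArrMonoid.not_isArtinMonoid hm⟩
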